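/- **Setting.** Let $X$ be a finite set with a semimetric $d$ (that is, $d(x,y)=d(y,x)\ge 0$, with $d(x,y)=0$ iff $x=y$; the triangle inequality is not required), and fix a labelling of the points of $X$ by $1,\dots,|X|$. A $p$-simplex is a subset of $X$ with $p+1$ elements, and $\operatorname{diam}\sigma=\max_{x,y\in\sigma}d(x,y)$. Order the simplices by diameter, then by dimension, then lexicographically by the increasingly sorted lists of vertex labels; write $\sigma<\tau$ for this total order. Homology is simplicial homology with $\mathbb Z/2$ coefficients. For $r\in[0,\infty)$ the Vietoris–Rips complex $\mathcal V_r(X)$ consists of all simplices of diameter at most $r$. Fix an integer $q>0$. *Lunes.* The lune of a simplex $\sigma=\langle y_0\dots y_q\rangle$ is the set of all $x\in X$ such that $\langle x\,y_0\dots\widehat{y_i}\dots y_q\rangle<\sigma$ for all $i$. Two distinct points $u,v$ of the lune are joined by an edge if $\langle u\,v\,y_0\dots\widehat{y_i}\dots\widehat{y_j}\dots y_q\rangle<\sigma$ for all $i<j$; the connected components of the lune are those of this graph. A degree-$q$ lune function $L$ assigns to each $q$-simplex $\sigma$ the set $L(\sigma)$ that contains exactly one point of each connected component of the lune of $\sigma$,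 namely the one with the smallest label in that component. *Reduced complex.* Given $L$, the degree-$q$ reduced Vietoris–Rips complex $\mathcal R^q_r(X)$ consists of all $i$-simplices of diameter at most $r$ with $i\le q$, and of the $(q+1)$-simplices $\sigma\cup\{x\}$, where $\sigma$ is a $q$-simplex of diameter at most $r$ and $x\in L(\sigma)$. Put $\mathcal R^q_\infty(X)=\bigcup_r\mathcal R^q_r(X)$. *Matching.* For each $q$-simplex $\sigma$ with $L(\sigma)\ne\emptyset$ let $x_\sigma$ be the point of $L(\sigma)$ with the smallest label, and match $\sigma$ with $\sigma\cup\{x_\sigma\}$: $\mu_q(\sigma)=\sigma\cup\{x_\sigma\}$ and $\mu_q(\sigma\cup\{x_\sigma\})=\sigma$. A $(q+1)$-simplex of $\mathcal R^q_\infty(X)$ is critical if it is not matched. Let $G$ be the directed graph on the $(q+1)$-simplices of $\mathcal R^q_\infty(X)$ with an edge $(\alpha,\beta)$ whenever $\mu_q(\beta)$ is defined and is a codimension-one face of $\alpha$, and let $A$ be the set of all $(q+1)$-simplices reachable in $G$ by a directed path (possibly of length $0$) from a critical $(q+1)$-simplex. *Distilled complex.* The degree-$q$ distilled Vietoris–Rips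 complex $\mathcal D^q_r(X)$ consists of all nonempty $\eta\subseteq\nu$ with $\nu\in A$ and $\operatorname{diam}\eta\le r$. **Theorem 3.6.** Let $X$ be a finite semimetric space, let $q>0$, and let $L$ be a degree-$q$ lune function. 1. There are isomorphisms $\psi_r:H_q(\mathcal R^q_r(X))\to H_q(\mathcal D^q_r(X))$, $r\in[0,\infty)$, such that $\psi_{r_2}\circ f_{r_1}^{r_2}=g_{r_1}^{r_2}\circ\psi_{r_1}$ for all $r_1\le r_2$, where $f_{r_1}^{r_2}$ and $g_{r_1}^{r_2}$ are the maps induced in $H_q$ by the inclusions $\mathcal R^q_{r_1}(X)\subseteq\mathcal R^q_{r_2}(X)$ and $\mathcal D^q_{r_1}(X)\subseteq\mathcal D^q_{r_2}(X)$. 2. Likewise there are isomorphisms $\theta_r:H_q(\mathcal V_r(X))\to H_q(\mathcal D^q_r(X))$, $r\in[0,\infty)$, that commute with the maps induced by the inclusions $\mathcal V_{r_1}(X)\subseteq\mathcal V_{r_2}(X)$ and $\mathcal D^q_{r_1}(X)\subseteq\mathcal D^q_{r_2}(X)$ for all $r_1\le r_2$. -/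

import Mathlib

open scoped NNReal

/-! ## Simplicial homology with coefficients in `ℤ/2`

A simplicial complex is a `PreAbstractSimplicialComplex X`: a set of nonempty finite subsets of `X`
closed under passing to nonempty subsets. A `q`-simplex is a face with `q + 1` elements.
A chain is a finitely supported function `Finset X →₀ ZMod 2`, that is, a finite formal sum of
finite sets with coefficients in `ℤ/2`. -/

section Homology

variable {X : Type*}

/-- The boundary map `∂ ⟨v₀ … v_q⟩ = ∑ᵢ ⟨v₀ … v̂ᵢ … v_q⟩`, extended linearly. On vertices it is the
augmentation `⟨v⟩ ↦ ⟨⟩`, where `⟨⟩` (the empty set) spans `C₋₁ = ℤ/2`. -/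
noncomputable def simplexBoundary [DecidableEq X] :
    (Finset X →₀ ZMod 2) →ₗ[ZMod 2] (Finset X →₀ ZMod 2) :=
  Finsupp.linearCombination (ZMod 2)
    (fun σ : Finset X => ∑ v ∈ σ, Finsupp.single (σ.erase v) (1 : ZMod 2))

/-- The chain group `C_q(K)`: the formal sums of `q`-simplices of `K`. -/
noncomputable def chainGroup (K : PreAbstractSimplicialComplex X) (q : ℕ) :
    Submodule (ZMod 2) (Finset X →₀ ZMod 2) :=
  Finsupp.supported (ZMod 2) (ZMod 2) {σ | σ ∈ K ∧ σ.card = q + 1}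

/-- The group of `q`-cycles `Z_q(K)`. -/
noncomputable def cycleGroup [DecidableEq X] (K : PreAbstractSimplicialComplex X) (q : ℕ) :
    Submodule (ZMod 2) (Finset X →₀ ZMod 2) :=
  chainGroup K q ⊓ LinearMap.ker simplexBoundary

/-- The group of `q`-boundaries `B_q(K)`, the image of `C_{q+1}(K)` under `∂`. -/
noncomputable def boundaryGroup [DecidableEq X] (K : PreAbstractSimplicialComplex X) (q : ℕ) :
    Submodule (ZMod 2) (Finset X →₀ ZMod 2) :=
  (chainGroup K (q + 1)).map simplexBoundary

/-- The homology group `H_q(K) = Z_q(K) / B_q(K)`. -/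
abbrev SimplicialHomology [DecidableEq X] (K : PreAbstractSimplicialComplex X) (q : ℕ) : Type _ :=
  cycleGroup K q ⧸
    ((boundaryGroup K q).comap (cycleGroup K q).subtype : Submodule (ZMod 2) (cycleGroup K q))

theorem chainGroup_mono {K L : PreAbstractSimplicialComplex X} (h : K ≤ L) (q : ℕ) :
    chainGroup K q ≤ chainGroup L q :=
  Finsupp.supported_mono fun _ hσ => ⟨h hσ.1, hσ.2⟩

theorem cycleGroup_mono [DecidableEq X] {K L : PreAbstractSimplicialComplex X} (h : K ≤ L) (q : ℕ) :
    cycleGroup K q ≤ cycleGroup L q :=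
  inf_le_inf_right _ (chainGroup_mono h q)

theorem boundaryGroup_mono [DecidableEq X] {K L : PreAbstractSimplicialComplex X} (h : K ≤ L) (q : ℕ) :
    boundaryGroup K q ≤ boundaryGroup L q :=
  Submodule.map_mono (chainGroup_mono h (q + 1))

/-- The map `H_q(K) → H_q(L)`, `[c] ↦ [c]`, induced by an inclusion `K ≤ L` of complexes. -/
noncomputable def homologyInclusion [DecidableEq X] {K L : PreAbstractSimplicialComplex X}
    (h : K ≤ L) (q : ℕ) :
    SimplicialHomology K q →ₗ[ZMod 2] SimplicialHomology L q :=
  Submodule.mapQ _ _ (Submodule.inclusion (cycleGroup_mono h q))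
    (fun _ hc => boundaryGroup_mono h q hc)

end Homology

/-! ## Semimetrics, diameters, and the total order on simplices -/

/-- `d` is a semimetric: distances are nonnegative (they lie in `ℝ≥0`), symmetric, and vanish exactly
on the diagonal. The triangle inequality is not required. -/
structure IsSemimetric {X : Type*} (d : X → X → ℝ≥0) : Prop where
  eq_zero_iff : ∀ x y, d x y = 0 ↔ x = y
  symm : ∀ x y, d x y = d y x

section Rips

variable {X : Type*}

/-- The diameter `max_{x, y ∈ σ} d(x, y)`. -/
noncomputable def simplexDiam (d : X → X → ℝ≥0) (σ : Finset X) : ℝ≥0 :=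
  (σ ×ˢ σ).sup fun p => d p.1 p.2

theorem simplexDiam_mono (d : X → X → ℝ≥0) {σ τ : Finset X} (h : σ ⊆ τ) :
    simplexDiam d σ ≤ simplexDiam d τ :=
  Finset.sup_mono (Finset.product_subset_product h h)

/-- The labels of the vertices of `σ`, listed in increasing order. (The labels run over
`0, …, |X| - 1`.) -/
def sortedLabels [Fintype X] [DecidableEq X] (ψ : X ≃ Fin (Fintype.card X)) (σ : Finset X) : List (Fin (Fintype.card X)) :=
  (σ.image ψ).sort (· ≤ ·)

/-- The order `σ < τ` in which simplices enter the simplex-wise Vietoris–Rips filtration: by diameter,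
then by dimension, then by the lexicographic order of the sorted label lists. -/
def SimplexLT [Fintype X] [DecidableEq X] (d : X → X → ℝ≥0) (ψ : X ≃ Fin (Fintype.card X)) (σ τ : Finset X) : Prop :=
  simplexDiam d σ < simplexDiam d τ ∨
    (simplexDiam d σ = simplexDiam d τ ∧
      (σ.card < τ.card ∨ (σ.card = τ.card ∧ sortedLabels ψ σ < sortedLabels ψ τ)))

/-! ## Lunes and the reduced Vietoris–Rips complex -/

/-- The lune of `σ = ⟨y₀ … y_p⟩`: the points `x` with `⟨x y₀ … ŷᵢ … y_p⟩ < σ` for all `i`.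
(A vertex `x = yᵢ` of `σ` is never in the lune, since for that `i` the simplex is `σ` itself.) -/
def lune [Fintype X] [DecidableEq X] (d : X → X → ℝ≥0) (ψ : X ≃ Fin (Fintype.card X)) (σ : Finset X) : Set X :=
  {x | ∀ y ∈ σ, SimplexLT d ψ (insert x (σ.erase y)) σ}

/-- The graph on the lune of `σ = ⟨y₀ … y_q⟩` that joins `u ≠ v` if
`⟨u v y₀ … ŷᵢ … ŷⱼ … y_q⟩ < σ` for all `i < j`. -/
def luneGraph [Fintype X] [DecidableEq X] (d : X → X → ℝ≥0) (ψ : X ≃ Fin (Fintype.card X)) (σ : Finset X) :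
    SimpleGraph (lune d ψ σ) where
  Adj u v := u ≠ v ∧ ∀ y ∈ σ, ∀ z ∈ σ, y ≠ z →
    SimplexLT d ψ (insert (u : X) (insert (v : X) ((σ.erase y).erase z))) σ
  symm := ⟨fun u v h => ⟨h.1.symm, fun y hy z hz hyz => by
    rw [Finset.insert_comm]; exact h.2 y hy z hz hyz⟩⟩
  loopless := ⟨fun _ h => h.1 rfl⟩

/-- `L` is a degree-`q` lune function: for every `q`-simplex `σ`, the set `L σ` consists of points of
the lune of `σ`, exactly one from each connected component of the lune, namely the point of that
component that appears earliest in the filtration (vertices appear in the order of their labels). -/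
def IsLuneFunction [Fintype X] [DecidableEq X] (d : X → X → ℝ≥0) (ψ : X ≃ Fin (Fintype.card X)) (q : ℕ)
    (L : Finset X → Finset X) : Prop :=
  ∀ σ : Finset X, σ.card = q + 1 →
    (∀ x ∈ L σ, x ∈ lune d ψ σ) ∧
    ∀ c : (luneGraph d ψ σ).ConnectedComponent,
      ∃ x ∈ c.supp, (∀ y ∈ c.supp, ψ x ≤ ψ y) ∧ ∀ y ∈ c.supp, (y : X) ∈ L σ ↔ y = x

/-- The Vietoris–Rips complex at scale `r`. -/
def vietorisRips (d : X → X → ℝ≥0) (r : ℝ≥0) : PreAbstractSimplicialComplex X where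
  faces := {s | s.Nonempty ∧ simplexDiam d s ≤ r}
  isRelLowerSet_faces := fun _ hs =>
    ⟨hs.1, fun _ hts ht => ⟨ht, (simplexDiam_mono d hts).trans hs.2⟩⟩

/-- The `(q+1)`-simplices `⟨y₀ … y_q x⟩`, `x ∈ L(⟨y₀ … y_q⟩)`, of the degree-`q` reduced
Vietoris–Rips complex at infinite scale. -/
def reducedTopSimplices [DecidableEq X] (q : ℕ) (L : Finset X → Finset X) : Set (Finset X) :=
  {τ | ∃ σ : Finset X, σ.card = q + 1 ∧ ∃ x ∈ L σ, τ = insert x σ}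

/-- The degree-`q` reduced Vietoris–Rips complex at scale `r`: all `i`-simplices of diameter at most
`r` with `i ≤ q`, and the `(q+1)`-simplices `⟨y₀ … y_q x⟩` with `x ∈ L(⟨y₀ … y_q⟩)` at scale `r`.
For `q > 0` a point `x` of the lune of `σ` satisfies `diam (σ ∪ {x}) = diam σ`, so it does not matter
whether the scale is imposed on `⟨y₀ … y_q⟩` or on `⟨y₀ … y_q x⟩`. -/
def reducedRips [DecidableEq X] (d : X → X → ℝ≥0) (q : ℕ) (L : Finset X → Finset X) (r : ℝ≥0) :
    PreAbstractSimplicialComplex X where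
  faces := {s | s.Nonempty ∧ simplexDiam d s ≤ r ∧
    (s.card ≤ q + 1 ∨ s ∈ reducedTopSimplices q L)}
  isRelLowerSet_faces := by
    rintro s ⟨hs, hd, hc⟩
    refine ⟨hs, fun t hts ht => ⟨ht, (simplexDiam_mono d hts).trans hd, ?_⟩⟩
    rcases eq_or_ne t s with rfl | hne
    · exact hc
    · left
      have h1 : t.card < s.card := Finset.card_lt_card (lt_of_le_of_ne hts hne)
      rcases hc with hc | ⟨σ, hσ, x, -, rfl⟩
      · omega
      · have := Finset.card_insert_le x σ
        omega

/-! ## The matching and the distilled Vietoris–Rips complex -/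

/-- The partial matching `μ_q` on the reduced complex: `Matched ψ q L σ τ` says that `σ` is a
`q`-simplex with `L σ ≠ ∅` and `τ = ⟨x_σ σ⟩`, where `x_σ` is the earliest point of `L σ`; then
`μ_q(σ) = τ` and `μ_q(τ) = σ`. -/
def Matched [Fintype X] [DecidableEq X] (ψ : X ≃ Fin (Fintype.card X)) (q : ℕ) (L : Finset X → Finset X)
    (σ τ : Finset X) : Prop :=
  σ.card = q + 1 ∧ ∃ x ∈ L σ, (∀ y ∈ L σ, ψ x ≤ ψ y) ∧ τ = insert x σ

/-- The critical `(q+1)`-simplices `R_{q+1}(μ_q)`: those `(q+1)`-simplices of the reduced complex that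
are not matched (they could only be matched with a `q`-simplex). -/
def criticalTop [Fintype X] [DecidableEq X] (ψ : X ≃ Fin (Fintype.card X)) (q : ℕ) (L : Finset X → Finset X) :
    Set (Finset X) :=
  {τ | τ ∈ reducedTopSimplices q L ∧ ∀ σ, ¬ Matched ψ q L σ τ}

/-- The edges of the directed graph `G_{q+1}(μ_q)` on the `(q+1)`-simplices of the reduced complex:
`(α, β)` is an edge if `μ_q(β)` is defined and is covered by `α`. -/
def MorseEdge [Fintype X] [DecidableEq X] (ψ : X ≃ Fin (Fintype.card X)) (q : ℕ) (L : Finset X → Finset X)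
    (α β : Finset X) : Prop :=
  α ∈ reducedTopSimplices q L ∧ β ∈ reducedTopSimplices q L ∧ ∃ σ, Matched ψ q L σ β ∧ σ ⋖ α

/-- The `(q+1)`-simplices reachable from `α` by a directed path in `G_{q+1}(μ_q)`; the path of length
zero is allowed, so `α` itself is reachable. -/
def reach [Fintype X] [DecidableEq X] (ψ : X ≃ Fin (Fintype.card X)) (q : ℕ) (L : Finset X → Finset X) (α : Finset X) :
    Set (Finset X) :=
  {β | Relation.ReflTransGen (MorseEdge ψ q L) α β}

/-- The union `A` of the sets reachable from the critical `(q+1)`-simplices. -/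
def distilledTop [Fintype X] [DecidableEq X] (ψ : X ≃ Fin (Fintype.card X)) (q : ℕ) (L : Finset X → Finset X) :
    Set (Finset X) :=
  ⋃ α ∈ criticalTop ψ q L, reach ψ q L α

/-- The degree-`q` distilled Vietoris–Rips complex at scale `r`: the simplices of `A` together with all
their faces, each of them entering at its own diameter. -/
def distilledRips [Fintype X] [DecidableEq X] (d : X → X → ℝ≥0) (ψ : X ≃ Fin (Fintype.card X)) (q : ℕ)
    (L : Finset X → Finset X) (r : ℝ≥0) : PreAbstractSimplicialComplex X where
  faces := {s | s.Nonempty ∧ simplexDiam d s ≤ r ∧ ∃ ν ∈ distilledTop ψ q L, s ⊆ ν}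
  isRelLowerSet_faces := fun _ ⟨hs, hd, ν, hν, hsν⟩ =>
    ⟨hs, fun _ hts ht => ⟨ht, (simplexDiam_mono d hts).trans hd, ν, hν, hts.trans hsν⟩⟩

theorem vietorisRips_mono (d : X → X → ℝ≥0) {r₁ r₂ : ℝ≥0} (h : r₁ ≤ r₂) :
    vietorisRips d r₁ ≤ vietorisRips d r₂ :=
  fun _ hs => ⟨hs.1, hs.2.trans h⟩

theorem reducedRips_mono [DecidableEq X] (d : X → X → ℝ≥0) (q : ℕ) (L : Finset X → Finset X)
    {r₁ r₂ : ℝ≥0} (h : r₁ ≤ r₂) : reducedRips d q L r₁ ≤ reducedRips d q L r₂ :=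
  fun _ hs => ⟨hs.1, hs.2.1.trans h, hs.2.2⟩

theorem distilledRips_mono [Fintype X] [DecidableEq X] (d : X → X → ℝ≥0) (ψ : X ≃ Fin (Fintype.card X)) (q : ℕ)
    (L : Finset X → Finset X) {r₁ r₂ : ℝ≥0} (h : r₁ ≤ r₂) :
    distilledRips d ψ q L r₁ ≤ distilledRips d ψ q L r₂ :=
  fun _ hs => ⟨hs.1, hs.2.1.trans h, hs.2.2⟩

end Rips

/-! ### Chains mod 2, the boundary map, and maps induced by inclusions. -/

section Chains

variable {X : Type*}

/-! All isomorphisms are inverses of the maps induced by the inclusions of the distilled complex D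
into the reduced complex R and into the Vietoris–Rips complex V, so naturality is automatic
(`exists_natural_equiv`). It remains to show that these inclusions are bijective on H_q.

R and V have the same q-cycles, since they share all simplices of dimension at most q, and also the
same q-boundaries (`boundaryGroup_vietorisRips`). Indeed, a (q+1)-simplex is its greatest facet σ
plus a point of the lune of σ. Moving that point along an edge of the lune changes the boundary of
the simplex only by boundaries of simplices all of whose facets precede σ. Induction on σ therefore
lets one move to the representative in L(σ).

For D and R the matching acts like Gaussian elimination. Surjectivity: modulo boundaries a cycle
avoids every simplex with a nonempty lune set (`chainGroup_reducedRips_le`). The resulting cycle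
bounds some c at infinite scale. A matched σ cannot survive in ∂c, so each matched simplex of c
shares its partner σ with another simplex of c, whose own partner, if any, is greater. Climbing in
this way ends at a critical simplex, so c is supported on A (`mem_distilledTop_of_simplexBoundary`).
Injectivity: if ∂c lies in D, the part of c outside A also has its boundary in D. The greatest
partner occurring in that part would survive in the boundary, be a face of a simplex of A, and so
pull its match into A. Hence that part vanishes (`eq_zero_of_simplexBoundary_mem`). -/

theorem mem_chainGroup {K : PreAbstractSimplicialComplex X} {q : ℕ} {c : Finset X →₀ ZMod 2} :
    c ∈ chainGroup K q ↔ ∀ σ, c σ ≠ 0 → σ ∈ K ∧ σ.card = q + 1 := by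
  rw [chainGroup, Finsupp.mem_supported]
  simp [Set.subset_def]

theorem single_mem_chainGroup {K : PreAbstractSimplicialComplex X} {q : ℕ} {σ : Finset X}
    (h : σ ∈ K) (hc : σ.card = q + 1) : Finsupp.single σ (1 : ZMod 2) ∈ chainGroup K q :=
  Finsupp.single_mem_supported _ _ ⟨h, hc⟩

/-- A submodule containing all simplices of a set contains all chains supported on that set. -/
theorem supported_le_of_single_mem {s : Set (Finset X)}
    {S : Submodule (ZMod 2) (Finset X →₀ ZMod 2)}
    (h : ∀ σ ∈ s, Finsupp.single σ (1 : ZMod 2) ∈ S) :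
    Finsupp.supported (ZMod 2) (ZMod 2) s ≤ S := by
  rw [Finsupp.supported_eq_span_single, Submodule.span_le]
  rintro _ ⟨σ, hσ, rfl⟩
  exact h σ hσ

theorem chain_add_self (c : Finset X →₀ ZMod 2) : c + c = 0 := by
  ext σ
  exact CharTwo.add_self_eq_zero _

variable [DecidableEq X]

theorem simplexBoundary_single (σ : Finset X) :
    simplexBoundary (Finsupp.single σ (1 : ZMod 2)) =
      ∑ v ∈ σ, Finsupp.single (σ.erase v) (1 : ZMod 2) := by
  simp [simplexBoundary]

theorem simplexBoundary_single_insert {σ : Finset X} {x : X} (hx : x ∉ σ) :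
    simplexBoundary (Finsupp.single (insert x σ) (1 : ZMod 2)) =
      Finsupp.single σ 1 + ∑ v ∈ σ, Finsupp.single (insert x (σ.erase v)) (1 : ZMod 2) := by
  rw [simplexBoundary_single, Finset.sum_insert hx, Finset.erase_insert hx]
  congr 1
  refine Finset.sum_congr rfl fun v hv => ?_
  rw [Finset.erase_insert_of_ne]
  rintro rfl
  exact hx hv

theorem simplexBoundary_simplexBoundary (c : Finset X →₀ ZMod 2) :
    simplexBoundary (simplexBoundary c) = 0 := by
  suffices h : simplexBoundary ∘ₗ simplexBoundary (X := X) = 0 from LinearMap.congr_fun h c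
  refine Finsupp.lhom_ext' fun σ => LinearMap.ext_ring ?_
  simp only [LinearMap.comp_apply, Finsupp.lsingle_apply, simplexBoundary_single, map_sum,
    LinearMap.zero_apply]
  rw [Finset.sum_sigma']
  refine Finset.sum_involution (fun p _ => ⟨p.2, p.1⟩) ?_ ?_ ?_ ?_
  · rintro ⟨v, w⟩ _
    dsimp only
    rw [Finset.erase_right_comm]
    exact chain_add_self _
  · rintro ⟨v, w⟩ h _ he
    simp only [Finset.mem_sigma, Finset.mem_erase] at h
    simp only [Sigma.mk.injEq] at he
    exact h.2.1 he.1
  · rintro ⟨v, w⟩ h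
    simp only [Finset.mem_sigma, Finset.mem_erase] at h ⊢
    exact ⟨h.2.2, Ne.symm h.2.1, h.1⟩
  · rintro ⟨v, w⟩ _
    rfl

theorem covBy_iff_exists_erase {σ τ : Finset X} : σ ⋖ τ ↔ ∃ v ∈ τ, τ.erase v = σ := by
  rw [Finset.covBy_iff_exists_insert]
  constructor
  · rintro ⟨a, ha, rfl⟩
    exact ⟨a, Finset.mem_insert_self _ _, Finset.erase_insert ha⟩
  · rintro ⟨v, hv, rfl⟩
    exact ⟨v, Finset.notMem_erase _ _, Finset.insert_erase hv⟩

theorem simplexBoundary_single_apply (σ τ : Finset X) [Decidable (σ ⋖ τ)] :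
    simplexBoundary (Finsupp.single τ (1 : ZMod 2)) σ = if σ ⋖ τ then 1 else 0 := by
  rw [simplexBoundary_single, Finsupp.finsetSum_apply]
  split_ifs with h
  · obtain ⟨v, hv, rfl⟩ := covBy_iff_exists_erase.1 h
    rw [Finset.sum_eq_single_of_mem v hv, Finsupp.single_eq_same]
    intro w hw hwv
    refine Finsupp.single_eq_of_ne fun he => hwv ?_
    by_contra hne
    exact Finset.notMem_erase w τ (he ▸ Finset.mem_erase.2 ⟨hne, hw⟩)
  · refine Finset.sum_eq_zero fun v hv => Finsupp.single_eq_of_ne fun he => h ?_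
    exact covBy_iff_exists_erase.2 ⟨v, hv, he.symm⟩

open Classical in
theorem simplexBoundary_apply (c : Finset X →₀ ZMod 2) (σ : Finset X) :
    simplexBoundary c σ = ∑ τ ∈ c.support, if σ ⋖ τ then c τ else 0 := by
  conv_lhs => rw [← Finsupp.sum_single c, Finsupp.sum, map_sum, Finsupp.finsetSum_apply]
  refine Finset.sum_congr rfl fun τ _ => ?_
  rw [← mul_one (c τ), ← smul_eq_mul, ← Finsupp.smul_single, map_smul, Finsupp.smul_apply,
    simplexBoundary_single_apply]
  simp

theorem exists_coface_of_simplexBoundary_ne_zero {c : Finset X →₀ ZMod 2} {σ : Finset X}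
    (h : simplexBoundary c σ ≠ 0) : ∃ τ, c τ ≠ 0 ∧ σ ⋖ τ := by
  classical
  rw [simplexBoundary_apply] at h
  obtain ⟨τ, hτ, hne⟩ := Finset.exists_ne_zero_of_sum_ne_zero h
  refine ⟨τ, Finsupp.mem_support_iff.1 hτ, ?_⟩
  by_contra hcov
  exact hne (if_neg hcov)

/-- A face of exactly one simplex of a chain lies in its boundary. -/
theorem simplexBoundary_ne_zero_of_unique {c : Finset X →₀ ZMod 2} {σ β : Finset X}
    (hβ : c β ≠ 0) (hσβ : σ ⋖ β) (h : ∀ α, c α ≠ 0 → σ ⋖ α → α = β) :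
    simplexBoundary c σ ≠ 0 := by
  classical
  rw [simplexBoundary_apply, Finset.sum_eq_single_of_mem β (Finsupp.mem_support_iff.2 hβ),
    if_pos hσβ]
  · exact hβ
  · intro α hα hne
    exact if_neg fun hcov => hne (h α (Finsupp.mem_support_iff.1 hα) hcov)

/-- The cone operator `σ ↦ σ ∪ {a}`, which vanishes on the simplices containing `a`. -/
noncomputable def simplexCone (a : X) : (Finset X →₀ ZMod 2) →ₗ[ZMod 2] (Finset X →₀ ZMod 2) :=
  Finsupp.linearCombination (ZMod 2)
    (fun σ : Finset X => if a ∈ σ then 0 else Finsupp.single (insert a σ) (1 : ZMod 2))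

theorem simplexCone_single (a : X) (σ : Finset X) :
    simplexCone a (Finsupp.single σ (1 : ZMod 2)) =
      if a ∈ σ then 0 else Finsupp.single (insert a σ) (1 : ZMod 2) := by
  simp [simplexCone]

/-- The cone operator is a contracting homotopy of the augmented complex of all simplices. -/
theorem simplexBoundary_simplexCone (a : X) (c : Finset X →₀ ZMod 2) :
    simplexBoundary (simplexCone a c) + simplexCone a (simplexBoundary c) = c := by
  suffices h : simplexBoundary ∘ₗ simplexCone a + simplexCone a ∘ₗ simplexBoundary =
      LinearMap.id from LinearMap.congr_fun h c
  refine Finsupp.lhom_ext' fun σ => LinearMap.ext_ring ?_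
  simp only [LinearMap.comp_apply, Finsupp.lsingle_apply, LinearMap.add_apply, LinearMap.id_apply]
  rw [simplexCone_single, simplexBoundary_single, map_sum]
  simp only [simplexCone_single]
  split_ifs with ha
  · rw [map_zero, zero_add, Finset.sum_eq_single_of_mem a ha]
    · rw [if_neg (Finset.notMem_erase _ _), Finset.insert_erase ha]
    · intro v _ hv
      rw [if_pos (Finset.mem_erase.2 ⟨hv.symm, ha⟩)]
  · rw [simplexBoundary_single_insert ha, add_assoc]
    have : ∀ v ∈ σ, (if a ∈ σ.erase v then 0 else Finsupp.single (insert a (σ.erase v)) 1) =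
        Finsupp.single (insert a (σ.erase v)) (1 : ZMod 2) := fun v _ =>
      if_neg fun h => ha (Finset.mem_of_mem_erase h)
    rw [Finset.sum_congr rfl this, chain_add_self, add_zero]

theorem homologyInclusion_mk {K L : PreAbstractSimplicialComplex X} (h : K ≤ L) (q : ℕ)
    (z : cycleGroup K q) :
    homologyInclusion h q (Submodule.Quotient.mk z) =
      Submodule.Quotient.mk (Submodule.inclusion (cycleGroup_mono h q) z) :=
  rfl

theorem homologyInclusion_comp {K L M : PreAbstractSimplicialComplex X} (h : K ≤ L) (h' : L ≤ M)
    (h'' : K ≤ M) (q : ℕ) (c : SimplicialHomology K q) :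
    homologyInclusion h' q (homologyInclusion h q c) = homologyInclusion h'' q c := by
  induction c using Submodule.Quotient.induction_on with
  | H z => rfl

theorem homologyInclusion_bijective {K L : PreAbstractSimplicialComplex X} (h : K ≤ L) (q : ℕ)
    (inj : ∀ z ∈ cycleGroup K q, z ∈ boundaryGroup L q → z ∈ boundaryGroup K q)
    (surj : ∀ z ∈ cycleGroup L q, ∃ z' ∈ cycleGroup K q, z' - z ∈ boundaryGroup L q) :
    Function.Bijective (homologyInclusion h q) := by
  constructor
  · rw [injective_iff_map_eq_zero]
    intro c
    induction c using Submodule.Quotient.induction_on with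
    | H z =>
      intro hz
      rw [homologyInclusion_mk, Submodule.Quotient.mk_eq_zero] at hz
      rw [Submodule.Quotient.mk_eq_zero]
      exact inj z z.2 hz
  · intro c
    induction c using Submodule.Quotient.induction_on with
    | H z =>
      obtain ⟨z', hz', hb⟩ := surj z z.2
      refine ⟨Submodule.Quotient.mk ⟨z', hz'⟩, ?_⟩
      rw [homologyInclusion_mk, Submodule.Quotient.eq]
      exact hb

/-- Inverses of the isomorphisms induced by inclusions of a filtration into another one form an
isomorphism of persistence modules. -/
theorem exists_natural_equiv {ι : Type*} [Preorder ι] {K L : ι → PreAbstractSimplicialComplex X}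
    (hK : ∀ {r s : ι}, r ≤ s → K r ≤ K s) (hL : ∀ {r s : ι}, r ≤ s → L r ≤ L s)
    (hKL : ∀ r, K r ≤ L r) (q : ℕ) (hbij : ∀ r, Function.Bijective (homologyInclusion (hKL r) q)) :
    ∃ Φ : ∀ r, SimplicialHomology (L r) q ≃ₗ[ZMod 2] SimplicialHomology (K r) q,
      ∀ (r s : ι) (h : r ≤ s) (c : SimplicialHomology (L r) q),
        Φ s (homologyInclusion (hL h) q c) = homologyInclusion (hK h) q (Φ r c) := by
  refine ⟨fun r => (LinearEquiv.ofBijective _ (hbij r)).symm, fun r s h c => ?_⟩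
  rw [LinearEquiv.symm_apply_eq]
  obtain ⟨b, rfl⟩ := (hbij r).2 c
  rw [← LinearEquiv.ofBijective_apply _ (hf := hbij r), LinearEquiv.symm_apply_apply,
    LinearEquiv.ofBijective_apply, LinearEquiv.ofBijective_apply,
    homologyInclusion_comp _ _ ((hKL r).trans (hL h)),
    homologyInclusion_comp _ _ ((hKL r).trans (hL h))]

end Chains

/-! ### The order on simplices, and equality of cycles and boundaries for V and R. -/

section SimplexOrder

variable {X : Type*} [Fintype X] [DecidableEq X] {d : X → X → ℝ≥0}
  {ψ : X ≃ Fin (Fintype.card X)} {q : ℕ} {L : Finset X → Finset X} {r : ℝ≥0}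

/-- The order of simplices is pulled back from a lexicographic order along this map. -/
noncomputable def simplexKey (d : X → X → ℝ≥0) (ψ : X ≃ Fin (Fintype.card X)) (σ : Finset X) :
    ℝ≥0 ×ₗ ℕ ×ₗ List (Fin (Fintype.card X)) :=
  toLex (simplexDiam d σ, toLex (σ.card, sortedLabels ψ σ))

theorem simplexLT_iff {σ τ : Finset X} :
    SimplexLT d ψ σ τ ↔ simplexKey d ψ σ < simplexKey d ψ τ := by
  simp only [simplexKey, Prod.Lex.toLex_lt_toLex, SimplexLT]

theorem simplexKey_injective : Function.Injective (simplexKey d ψ) := by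
  intro σ τ h
  simp only [simplexKey, EmbeddingLike.apply_eq_iff_eq, Prod.mk.injEq] at h
  have h' := congrArg List.toFinset h.2.2
  simp only [sortedLabels, Finset.sort_toFinset] at h'
  exact Finset.image_injective ψ.injective h'

theorem simplexLT_wellFounded : WellFounded (SimplexLT d ψ) := by
  have : IsTrans (Finset X) (SimplexLT d ψ) :=
    ⟨fun _ _ _ h h' => simplexLT_iff.2 ((simplexLT_iff.1 h).trans (simplexLT_iff.1 h'))⟩
  have : Std.Irrefl (SimplexLT d ψ) := ⟨fun _ h => (simplexLT_iff.1 h).false⟩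
  exact Finite.wellFounded_of_trans_of_irrefl _

/-- Finiteness of X also allows induction from the greatest simplex downwards, as needed when
following matched simplices towards greater partners. -/
theorem simplexLT_wellFounded_swap : WellFounded (Function.swap (SimplexLT d ψ)) := by
  have : IsTrans (Finset X) (Function.swap (SimplexLT d ψ)) :=
    ⟨fun _ _ _ h h' => simplexLT_iff.2 ((simplexLT_iff.1 h').trans (simplexLT_iff.1 h))⟩
  have : Std.Irrefl (Function.swap (SimplexLT d ψ)) := ⟨fun _ h => (simplexLT_iff.1 h).false⟩
  exact Finite.wellFounded_of_trans_of_irrefl _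

theorem SimplexLT.diam_le {σ τ : Finset X} (h : SimplexLT d ψ σ τ) :
    simplexDiam d σ ≤ simplexDiam d τ := by
  rcases h with h | h
  · exact h.le
  · exact h.1.le

-- The diameter involves only two vertices at a time, and with at least three vertices some facet
-- still contains any given two.
omit [Fintype X] in
theorem simplexDiam_le_of_facets {τ : Finset X} (hτ : 3 ≤ τ.card)
    (h : ∀ v ∈ τ, simplexDiam d (τ.erase v) ≤ r) : simplexDiam d τ ≤ r := by
  refine Finset.sup_le fun p hp => ?_
  rw [Finset.mem_product] at hp
  obtain ⟨v, hv, hvp⟩ := Finset.exists_mem_notMem_of_card_lt_card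
    (s := {p.1, p.2}) (t := τ) (Finset.card_le_two.trans_lt hτ)
  simp only [Finset.mem_insert, Finset.mem_singleton, not_or] at hvp
  refine le_trans ?_ (h v hv)
  exact Finset.le_sup (f := fun p : X × X => d p.1 p.2) (Finset.mem_product.2
    ⟨Finset.mem_erase.2 ⟨Ne.symm hvp.1, hp.1⟩, Finset.mem_erase.2 ⟨Ne.symm hvp.2, hp.2⟩⟩)

theorem notMem_of_mem_lune {σ : Finset X} {x : X} (hx : x ∈ lune d ψ σ) : x ∉ σ := by
  intro h
  have := hx x h
  rw [Finset.insert_erase h, simplexLT_iff] at this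
  exact this.false

/-- This is where q > 0 matters: the simplex then has at least three vertices, so its facets control
its diameter, and none of them is wider than σ. -/
theorem simplexDiam_insert_le_of_mem_lune (hq : 0 < q) {σ : Finset X} (hσ : σ.card = q + 1) {x : X}
    (hx : x ∈ lune d ψ σ) : simplexDiam d (insert x σ) ≤ simplexDiam d σ := by
  have hxσ := notMem_of_mem_lune hx
  refine simplexDiam_le_of_facets (by rw [Finset.card_insert_of_notMem hxσ]; omega) ?_
  intro v hv
  rcases Finset.mem_insert.1 hv with rfl | hv
  · rw [Finset.erase_insert hxσ]
  · rw [Finset.erase_insert_of_ne (by rintro rfl; exact hxσ hv)]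
    exact (hx v hv).diam_le

/-- Every simplex is the union of its greatest facet and a point of the lune of that facet. -/
theorem exists_mem_lune_erase {τ : Finset X} (hτ : τ.Nonempty) :
    ∃ v ∈ τ, v ∈ lune d ψ (τ.erase v) := by
  obtain ⟨v, hv, hmax⟩ := Finset.exists_max_image τ (fun v => simplexKey d ψ (τ.erase v)) hτ
  refine ⟨v, hv, fun y hy => ?_⟩
  obtain ⟨hyv, hy⟩ := Finset.mem_erase.1 hy
  rw [Finset.erase_right_comm, Finset.insert_erase (Finset.mem_erase.2 ⟨Ne.symm hyv, hv⟩),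
    simplexLT_iff]
  refine lt_of_le_of_ne (hmax y hy) fun h => ?_
  have := simplexKey_injective h
  exact Finset.notMem_erase y τ (this ▸ Finset.mem_erase.2 ⟨hyv, hy⟩)

theorem insert_mem_reducedRips (hq : 0 < q) (hL : IsLuneFunction d ψ q L) {σ : Finset X}
    (hσ : σ.card = q + 1) (hr : simplexDiam d σ ≤ r) {x : X} (hx : x ∈ L σ) :
    insert x σ ∈ reducedRips d q L r :=
  ⟨Finset.insert_nonempty _ _,
    (simplexDiam_insert_le_of_mem_lune hq hσ ((hL σ hσ).1 x hx)).trans hr,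
    Or.inr ⟨σ, hσ, x, hx, rfl⟩⟩

theorem single_insert_mem_chainGroup (hq : 0 < q) (hL : IsLuneFunction d ψ q L) {σ : Finset X}
    (hσ : σ.card = q + 1) (hr : simplexDiam d σ ≤ r) {x : X} (hx : x ∈ L σ) :
    Finsupp.single (insert x σ) (1 : ZMod 2) ∈ chainGroup (reducedRips d q L r) (q + 1) :=
  single_mem_chainGroup (insert_mem_reducedRips hq hL hσ hr hx) (by
    rw [Finset.card_insert_of_notMem (notMem_of_mem_lune ((hL σ hσ).1 x hx)), hσ])

-- This is ∂∂ = 0 applied to σ ∪ {u, v}. It measures the effect of replacing the lune point v by u.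
omit [Fintype X] in
theorem simplexBoundary_insert_insert {σ : Finset X} {u v : X} (hu : u ∉ σ) (hv : v ∉ σ)
    (huv : u ≠ v) :
    simplexBoundary (Finsupp.single (insert u σ) (1 : ZMod 2)) =
      simplexBoundary (Finsupp.single (insert v σ) 1) +
        ∑ w ∈ σ, simplexBoundary (Finsupp.single (insert u (insert v (σ.erase w))) 1) := by
  have h := simplexBoundary_simplexBoundary
    (Finsupp.single (insert u (insert v σ)) (1 : ZMod 2))
  rw [simplexBoundary_single_insert (by simp [hu, huv]), Finset.sum_insert hv,
    Finset.erase_insert hv, map_add, map_add, map_sum] at h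
  have hs : ∀ w ∈ σ, (insert v σ).erase w = insert v (σ.erase w) := fun w hw =>
    Finset.erase_insert_of_ne (by rintro rfl; exact hv hw)
  rw [Finset.sum_congr rfl fun w hw => by rw [hs w hw]] at h
  rw [← add_assoc, add_right_comm] at h
  rw [← add_right_inj (simplexBoundary (Finsupp.single (insert u σ) 1)), chain_add_self, ← h]
  abel

/-- Strong induction on σ. The claim holds by definition at the representative of the component of
x, and it propagates along a walk in the lune, each edge costing only boundaries covered by the
induction hypothesis. -/
theorem simplexBoundary_single_insert_mem (hq : 0 < q) (hL : IsLuneFunction d ψ q L)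
    (σ : Finset X) (hσ : σ.card = q + 1) (hr : simplexDiam d σ ≤ r) (x : X)
    (hx : x ∈ lune d ψ σ) :
    simplexBoundary (Finsupp.single (insert x σ) (1 : ZMod 2)) ∈
      boundaryGroup (reducedRips d q L r) q := by
  induction σ using (simplexLT_wellFounded (d := d) (ψ := ψ)).induction generalizing x with
  | _ σ ih =>
  -- The induction hypothesis is used at the greatest facet of τ, which precedes σ and has the
  -- remaining vertex of τ in its lune.
  have small : ∀ τ : Finset X, τ.card = q + 2 → (∀ v ∈ τ, SimplexLT d ψ (τ.erase v) σ) →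
      simplexBoundary (Finsupp.single τ (1 : ZMod 2)) ∈
        boundaryGroup (reducedRips d q L r) q := by
    intro τ hτ hlt
    obtain ⟨v, hv, hvl⟩ := exists_mem_lune_erase (d := d) (ψ := ψ) (τ := τ)
      (Finset.card_pos.1 (by omega))
    have := ih _ (hlt v hv) (by rw [Finset.card_erase_of_mem hv]; omega)
      ((hlt v hv).diam_le.trans hr) v hvl
    rwa [Finset.insert_erase hv] at this
  have adj : ∀ u v : lune d ψ σ, (luneGraph d ψ σ).Adj u v →
      simplexBoundary (Finsupp.single (insert (v : X) σ) (1 : ZMod 2)) ∈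
        boundaryGroup (reducedRips d q L r) q →
      simplexBoundary (Finsupp.single (insert (u : X) σ) (1 : ZMod 2)) ∈
        boundaryGroup (reducedRips d q L r) q := by
    rintro ⟨u, hu⟩ ⟨v, hv⟩ ⟨huv, hadj⟩ hmem
    have huv : u ≠ v := fun h => huv (Subtype.ext h)
    have huσ := notMem_of_mem_lune hu
    have hvσ := notMem_of_mem_lune hv
    dsimp only at hmem hadj ⊢
    rw [simplexBoundary_insert_insert huσ hvσ huv]
    refine Submodule.add_mem _ hmem (Submodule.sum_mem _ fun w hw => small _ ?_ ?_)
    · rw [Finset.card_insert_of_notMem (by simp [huv, huσ]),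
        Finset.card_insert_of_notMem (by simp [hvσ]), Finset.card_erase_of_mem hw]
      omega
    -- The facets omitting u or v precede σ because v and u are lune points; those retaining both
    -- precede σ by adjacency.
    · intro z hz
      rw [Finset.mem_insert, Finset.mem_insert] at hz
      rcases hz with rfl | rfl | hz
      · rw [Finset.erase_insert (by simp [huv, huσ])]
        exact hv w hw
      · rw [Finset.insert_comm, Finset.erase_insert (by simp [huv.symm, hvσ])]
        exact hu w hw
      · have hzσ := Finset.mem_of_mem_erase hz
        rw [Finset.erase_insert_of_ne (by rintro rfl; exact huσ hzσ),
          Finset.erase_insert_of_ne (by rintro rfl; exact hvσ hzσ)]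
        exact hadj w hw z hzσ (Finset.ne_of_mem_erase hz).symm
  obtain ⟨u, hu, -, huL⟩ := (hL σ hσ).2 ((luneGraph d ψ σ).connectedComponentMk ⟨x, hx⟩)
  have hreach : (luneGraph d ψ σ).Reachable ⟨x, hx⟩ u :=
    (SimpleGraph.ConnectedComponent.exact hu).symm
  have huL : (u : X) ∈ L σ := (huL u hu).2 rfl
  have hbase : simplexBoundary (Finsupp.single (insert (u : X) σ) (1 : ZMod 2)) ∈
      boundaryGroup (reducedRips d q L r) q :=
    Submodule.mem_map.2 ⟨_, single_insert_mem_chainGroup hq hL hσ hr huL, rfl⟩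
  obtain ⟨p⟩ := hreach
  have walk : ∀ {a b : lune d ψ σ}, (luneGraph d ψ σ).Walk a b →
      simplexBoundary (Finsupp.single (insert (b : X) σ) (1 : ZMod 2)) ∈
        boundaryGroup (reducedRips d q L r) q →
      simplexBoundary (Finsupp.single (insert (a : X) σ) (1 : ZMod 2)) ∈
        boundaryGroup (reducedRips d q L r) q := by
    intro a b p
    induction p with
    | nil => exact id
    | cons h _ ihp => exact fun hb => adj _ _ h (ihp hb)
  have hxu := walk p
  dsimp only at hxu
  exact hxu hbase

omit [Fintype X] in
theorem reducedRips_le_vietorisRips : reducedRips d q L r ≤ vietorisRips d r :=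
  fun _ hs => ⟨hs.1, hs.2.1⟩

/-- Each (q+1)-simplex of V splits as its greatest facet plus a lune point, so its boundary is
already a boundary in R at the same scale. -/
theorem boundaryGroup_vietorisRips (hq : 0 < q) (hL : IsLuneFunction d ψ q L) :
    boundaryGroup (vietorisRips d r) q = boundaryGroup (reducedRips d q L r) q := by
  refine le_antisymm ?_ (boundaryGroup_mono reducedRips_le_vietorisRips q)
  rw [boundaryGroup, Submodule.map_le_iff_le_comap]
  refine supported_le_of_single_mem fun τ hτ => ?_
  obtain ⟨⟨hne, hd⟩, hτ⟩ := hτ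
  obtain ⟨v, hv, hvl⟩ := exists_mem_lune_erase (d := d) (ψ := ψ) hne
  have := simplexBoundary_single_insert_mem (r := r) hq hL (τ.erase v)
    (by rw [Finset.card_erase_of_mem hv]; omega)
    ((simplexDiam_mono d (Finset.erase_subset v τ)).trans hd) v hvl
  rw [Finset.insert_erase hv] at this
  exact this

omit [Fintype X] in
theorem cycleGroup_vietorisRips :
    cycleGroup (vietorisRips d r) q = cycleGroup (reducedRips d q L r) q := by
  refine le_antisymm (inf_le_inf_right _ ?_) (cycleGroup_mono reducedRips_le_vietorisRips q)
  exact Finsupp.supported_mono fun _ hσ => ⟨⟨hσ.1.1, hσ.1.2, Or.inl hσ.2.le⟩, hσ.2⟩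

end SimplexOrder

/-! ### The matching, and comparison of R with D. -/

section Matching

variable {X : Type*} [Fintype X] [DecidableEq X] {d : X → X → ℝ≥0}
  {ψ : X ≃ Fin (Fintype.card X)} {q : ℕ} {L : Finset X → Finset X} {r : ℝ≥0}

theorem Matched.mem_reducedTopSimplices {σ τ : Finset X} (h : Matched ψ q L σ τ) :
    τ ∈ reducedTopSimplices q L := by
  obtain ⟨hσ, x, hx, -, rfl⟩ := h
  exact ⟨σ, hσ, x, hx, rfl⟩

theorem Matched.right_unique {σ τ τ' : Finset X} (h : Matched ψ q L σ τ)
    (h' : Matched ψ q L σ τ') : τ = τ' := by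
  obtain ⟨-, x, hx, hmin, rfl⟩ := h
  obtain ⟨-, x', hx', hmin', rfl⟩ := h'
  rw [ψ.injective (le_antisymm (hmin x' hx') (hmin' x hx))]

theorem Matched.covBy (hL : IsLuneFunction d ψ q L) {σ τ : Finset X} (h : Matched ψ q L σ τ) :
    σ ⋖ τ := by
  obtain ⟨hσ, x, hx, -, rfl⟩ := h
  exact Finset.covBy_insert (notMem_of_mem_lune ((hL σ hσ).1 x hx))

/-- A matched `q`-simplex is the greatest facet of its partner. -/
theorem Matched.simplexLT (hL : IsLuneFunction d ψ q L) {σ ρ τ : Finset X}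
    (h : Matched ψ q L σ τ) (hρ : ρ ⋖ τ) (hne : ρ ≠ σ) : SimplexLT d ψ ρ σ := by
  obtain ⟨hσ, x, hx, -, rfl⟩ := h
  have hlune := (hL σ hσ).1 x hx
  have hxσ := notMem_of_mem_lune hlune
  obtain ⟨v, hv, rfl⟩ := covBy_iff_exists_erase.1 hρ
  rcases Finset.mem_insert.1 hv with rfl | hv
  · exact absurd (Finset.erase_insert hxσ) hne
  · rw [Finset.erase_insert_of_ne (by rintro rfl; exact hxσ hv)]
    exact hlune v hv

theorem mem_distilledTop_of_critical {τ : Finset X} (h : τ ∈ reducedTopSimplices q L)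
    (h' : ∀ σ, ¬ Matched ψ q L σ τ) : τ ∈ distilledTop ψ q L :=
  Set.mem_biUnion (x := τ) ⟨h, h'⟩ Relation.ReflTransGen.refl

theorem distilledTop_subset : distilledTop ψ q L ⊆ reducedTopSimplices q L := by
  intro τ hτ
  simp only [distilledTop, Set.mem_iUnion] at hτ
  obtain ⟨α, hα, hατ⟩ := hτ
  rcases Relation.ReflTransGen.cases_tail hατ with rfl | ⟨β, -, hβ⟩
  · exact hα.1
  · exact hβ.2.1

theorem Matched.mem_distilledTop {σ α β : Finset X} (h : Matched ψ q L σ β) (hσ : σ ⋖ α)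
    (hα : α ∈ distilledTop ψ q L) : β ∈ distilledTop ψ q L := by
  have hαtop := distilledTop_subset hα
  simp only [distilledTop, Set.mem_iUnion] at hα ⊢
  obtain ⟨γ, hγ, hγα⟩ := hα
  exact ⟨γ, hγ, Relation.ReflTransGen.tail hγα ⟨hαtop, h.mem_reducedTopSimplices, σ, h, hσ⟩⟩

theorem card_of_mem_reducedTopSimplices (hL : IsLuneFunction d ψ q L) {τ : Finset X}
    (h : τ ∈ reducedTopSimplices q L) : τ.card = q + 2 := by
  obtain ⟨σ, hσ, x, hx, rfl⟩ := h
  rw [Finset.card_insert_of_notMem (notMem_of_mem_lune ((hL σ hσ).1 x hx)), hσ]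

theorem distilledRips_le_reducedRips (hL : IsLuneFunction d ψ q L) :
    distilledRips d ψ q L r ≤ reducedRips d q L r := by
  rintro s ⟨hs, hd, ν, hν, hsν⟩
  refine ⟨hs, hd, ?_⟩
  rcases eq_or_ne s ν with rfl | hne
  · exact Or.inr (distilledTop_subset hν)
  · have h1 := Finset.card_lt_card (lt_of_le_of_ne hsν hne)
    rw [card_of_mem_reducedTopSimplices hL (distilledTop_subset hν)] at h1
    exact Or.inl (by omega)

omit [Fintype X] in
theorem mem_chainGroup_reducedRips_top {c : Finset X →₀ ZMod 2}
    (hc : c ∈ chainGroup (reducedRips d q L r) (q + 1)) {τ : Finset X} (hτ : c τ ≠ 0) :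
    τ ∈ reducedTopSimplices q L ∧ simplexDiam d τ ≤ r := by
  obtain ⟨⟨-, hd, h⟩, hcard⟩ := mem_chainGroup.1 hc τ hτ
  exact ⟨h.resolve_left (by omega), hd⟩

/-- Modulo boundaries, every `q`-chain is supported on simplices with empty lune sets. -/
theorem chainGroup_reducedRips_le (hq : 0 < q) (hL : IsLuneFunction d ψ q L) :
    chainGroup (reducedRips d q L r) q ≤ boundaryGroup (reducedRips d q L r) q ⊔
      Finsupp.supported (ZMod 2) (ZMod 2)
        {σ | (σ ∈ reducedRips d q L r ∧ σ.card = q + 1) ∧ L σ = ∅} := by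
  refine supported_le_of_single_mem fun σ hσ => ?_
  induction σ using (simplexLT_wellFounded (d := d) (ψ := ψ)).induction with
  | _ σ ih =>
  rcases (L σ).eq_empty_or_nonempty with hLσ | ⟨x, hx⟩
  · exact Submodule.mem_sup_right (Finsupp.single_mem_supported _ _ ⟨hσ, hLσ⟩)
  · have hlune := (hL σ hσ.2).1 x hx
    have hb : simplexBoundary (Finsupp.single (insert x σ) (1 : ZMod 2)) ∈
        boundaryGroup (reducedRips d q L r) q :=
      Submodule.mem_map.2 ⟨_, single_insert_mem_chainGroup hq hL hσ.2 hσ.1.2.1 hx, rfl⟩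
    rw [simplexBoundary_single_insert (notMem_of_mem_lune hlune)] at hb
    -- The boundary of σ ∪ {x} is σ plus facets preceding σ; these lie in the sum by induction,
    -- hence so does σ.
    refine (Submodule.add_mem_iff_left _ (Submodule.sum_mem _ fun v hv => ?_)).1
      (Submodule.mem_sup_left hb)
    have hcard : (insert x (σ.erase v)).card = q + 1 := by
      rw [Finset.card_insert_of_notMem fun h =>
        notMem_of_mem_lune hlune (Finset.mem_of_mem_erase h), Finset.card_erase_of_mem hv, hσ.2]
      omega
    exact ih _ (hlune v hv) ⟨⟨Finset.insert_nonempty _ _,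
      (hlune v hv).diam_le.trans hσ.1.2.1, Or.inl hcard.le⟩, hcard⟩

/-- Every cycle bounds in the reduced complex at infinite scale. -/
theorem exists_simplexBoundary_eq (hq : 0 < q) (hL : IsLuneFunction d ψ q L)
    {z : Finset X →₀ ZMod 2} (hz : z ∈ cycleGroup (reducedRips d q L r) q) :
    ∃ c, (∀ τ, c τ ≠ 0 → τ ∈ reducedTopSimplices q L) ∧ simplexBoundary c = z := by
  -- At the diameter of X every simplex is present in V, so V is a full simplex and coning off a
  -- vertex fills every cycle.
  suffices h : z ∈ boundaryGroup (reducedRips d q L (simplexDiam d Finset.univ)) q by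
    obtain ⟨c, hc, rfl⟩ := h
    exact ⟨c, fun τ hτ => (mem_chainGroup_reducedRips_top hc hτ).1, rfl⟩
  rw [← boundaryGroup_vietorisRips hq hL]
  obtain ⟨hz, hz0⟩ := hz
  rcases isEmpty_or_nonempty X with hX | ⟨⟨a⟩⟩
  · have : z = 0 := by
      refine Finsupp.ext fun σ => ?_
      by_contra hσ
      obtain ⟨⟨⟨x, -⟩, -⟩, -⟩ := mem_chainGroup.1 hz σ hσ
      exact hX.false x
    rw [this]
    exact Submodule.zero_mem _
  · refine Submodule.mem_map.2 ⟨simplexCone a z, ?_, ?_⟩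
    · have hle : chainGroup (reducedRips d q L r) q ≤ (chainGroup (vietorisRips d
          (simplexDiam d Finset.univ)) (q + 1)).comap (simplexCone a) := by
        refine supported_le_of_single_mem fun σ hσ => ?_
        rw [Submodule.mem_comap, simplexCone_single]
        split_ifs with ha
        · exact Submodule.zero_mem _
        · refine single_mem_chainGroup ⟨Finset.insert_nonempty _ _,
            simplexDiam_mono d (Finset.subset_univ _)⟩ ?_
          rw [Finset.card_insert_of_notMem ha, hσ.2]
      exact hle hz
    · have := simplexBoundary_simplexCone a z
      rwa [LinearMap.mem_ker.1 hz0, map_zero, add_zero] at this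

/-- A top-dimensional chain is supported on the distilled simplices if its boundary contains no
simplex with a nonempty lune set. -/
theorem mem_distilledTop_of_simplexBoundary (hL : IsLuneFunction d ψ q L)
    {c : Finset X →₀ ZMod 2} (hc : ∀ τ, c τ ≠ 0 → τ ∈ reducedTopSimplices q L)
    (hcL : ∀ σ, simplexBoundary c σ ≠ 0 → L σ = ∅) {β : Finset X} (hβ : c β ≠ 0) :
    β ∈ distilledTop ψ q L := by
  have matched : ∀ σ β, Matched ψ q L σ β → c β ≠ 0 → β ∈ distilledTop ψ q L := by
    intro σ
    induction σ using (simplexLT_wellFounded_swap (d := d) (ψ := ψ)).induction with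
    | _ σ ih =>
    intro β hm hβ
    -- Since L σ is nonempty, σ is absent from ∂c, so β cannot be the only simplex of c above σ.
    obtain ⟨α, hα, hσα, hne⟩ : ∃ α, c α ≠ 0 ∧ σ ⋖ α ∧ α ≠ β := by
      by_contra! h
      have hLσ := hcL σ (simplexBoundary_ne_zero_of_unique hβ (hm.covBy hL) h)
      obtain ⟨-, x, hx, -⟩ := hm
      simp [hLσ] at hx
    refine hm.mem_distilledTop hσα ?_
    by_cases hcrit : ∃ σ', Matched ψ q L σ' α
    · obtain ⟨σ', hm'⟩ := hcrit
      -- σ is a facet of α other than its partner σ', so σ' is strictly greater and the climb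
      -- terminates.
      refine ih σ' (hm'.simplexLT hL hσα ?_) α hm' hα
      rintro rfl
      exact hne (hm'.right_unique hm)
    · exact mem_distilledTop_of_critical (hc α hα) (not_exists.1 hcrit)
  by_cases hcrit : ∃ σ, Matched ψ q L σ β
  · obtain ⟨σ, hm⟩ := hcrit
    exact matched σ β hm hβ
  · exact mem_distilledTop_of_critical (hc β hβ) (not_exists.1 hcrit)

/-- Surjectivity for D in R: the representative avoiding nonempty lune sets lies in D because a
chain that it bounds is supported on A. -/
theorem exists_homologous_mem_cycleGroup_distilledRips (hq : 0 < q) (hL : IsLuneFunction d ψ q L)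
    {z : Finset X →₀ ZMod 2} (hz : z ∈ cycleGroup (reducedRips d q L r) q) :
    ∃ z' ∈ cycleGroup (distilledRips d ψ q L r) q,
      z' - z ∈ boundaryGroup (reducedRips d q L r) q := by
  obtain ⟨b, hb, z', hz', hbz⟩ := Submodule.mem_sup.1 (chainGroup_reducedRips_le hq hL hz.1)
  rw [Finsupp.mem_supported'] at hz'
  have hz'' : ∀ σ, z' σ ≠ 0 → (σ ∈ reducedRips d q L r ∧ σ.card = q + 1) ∧ L σ = ∅ :=
    fun σ hσ => by_contra fun h => hσ (hz' σ h)
  have hb0 : simplexBoundary b = 0 := by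
    obtain ⟨c, -, rfl⟩ := hb
    exact simplexBoundary_simplexBoundary c
  have hz'0 : simplexBoundary z' = 0 := by
    have := LinearMap.mem_ker.1 hz.2
    rwa [← hbz, map_add, hb0, zero_add] at this
  have hz'R : z' ∈ cycleGroup (reducedRips d q L r) q :=
    ⟨mem_chainGroup.2 fun σ hσ => (hz'' σ hσ).1, LinearMap.mem_ker.2 hz'0⟩
  obtain ⟨c, hc, hcz⟩ := exists_simplexBoundary_eq hq hL hz'R
  refine ⟨z', ⟨mem_chainGroup.2 fun σ hσ => ?_, LinearMap.mem_ker.2 hz'0⟩, ?_⟩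
  · obtain ⟨⟨hσR, hcard⟩, -⟩ := hz'' σ hσ
    obtain ⟨τ, hτ, hστ⟩ := exists_coface_of_simplexBoundary_ne_zero (c := c) (hcz ▸ hσ)
    -- The coface τ may have diameter greater than r. This is harmless, since faces of simplices of
    -- A enter D at their own diameter.
    refine ⟨⟨hσR.1, hσR.2.1, τ, ?_, hστ.le⟩, hcard⟩
    exact mem_distilledTop_of_simplexBoundary hL hc (fun ρ hρ => (hz'' ρ (hcz ▸ hρ)).2) hτ
  · rw [← hbz, sub_add_cancel_right]
    exact Submodule.neg_mem _ hb

/-- A chain of matched simplices outside the distilled complex whose boundary lies in the distilled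
complex is zero. -/
theorem eq_zero_of_simplexBoundary_mem (hL : IsLuneFunction d ψ q L) {c : Finset X →₀ ZMod 2}
    (hc : ∀ τ, c τ ≠ 0 → τ ∈ reducedTopSimplices q L ∧ τ ∉ distilledTop ψ q L)
    (hb : simplexBoundary c ∈ chainGroup (distilledRips d ψ q L r) q) : c = 0 := by
  suffices h : ∀ σ β, Matched ψ q L σ β → c β = 0 by
    ext β
    by_contra hβ
    exact (hc β hβ).2 (mem_distilledTop_of_critical (hc β hβ).1 fun σ hm => hβ (h σ β hm))
  intro σ
  induction σ using (simplexLT_wellFounded_swap (d := d) (ψ := ψ)).induction with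
  | _ σ ih =>
  intro β hm
  by_contra hβ
  have hne : simplexBoundary c σ ≠ 0 := by
    refine simplexBoundary_ne_zero_of_unique hβ (hm.covBy hL) fun α hα hσα => ?_
    by_contra hαβ
    refine (hc α hα).2 (mem_distilledTop_of_critical (hc α hα).1 fun σ' hm' => ?_)
    refine hα (ih σ' (hm'.simplexLT hL hσα ?_) α hm')
    rintro rfl
    exact hαβ (hm'.right_unique hm)
  -- Membership of σ in D puts it under some ν in A, and counting vertices makes it a facet. Then
  -- (ν, β) is an edge of G, so β lies in A.
  obtain ⟨⟨-, -, ν, hν, hσν⟩, hcard⟩ := mem_chainGroup.1 hb σ hne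
  refine (hc β hβ).2 (hm.mem_distilledTop ?_ hν)
  rw [Finset.covBy_iff_card_sdiff_eq_one]
  refine ⟨hσν, ?_⟩
  rw [Finset.card_sdiff_of_subset hσν, hcard,
    card_of_mem_reducedTopSimplices hL (distilledTop_subset hν)]
  omega

/-- Injectivity for D in R: split a bounding chain into its parts inside and outside A. The inner
part is a chain of D at scale r, and the outer part vanishes. -/
theorem mem_boundaryGroup_distilledRips (hL : IsLuneFunction d ψ q L)
    {z : Finset X →₀ ZMod 2} (hz : z ∈ chainGroup (distilledRips d ψ q L r) q)
    (hzb : z ∈ boundaryGroup (reducedRips d q L r) q) :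
    z ∈ boundaryGroup (distilledRips d ψ q L r) q := by
  classical
  obtain ⟨c, hc, rfl⟩ := hzb
  set a := c.filter (· ∈ distilledTop ψ q L) with ha_def
  set b := c.filter (· ∉ distilledTop ψ q L) with hb_def
  have hab : a + b = c := Finsupp.filter_add_filter_not c _
  have haD : a ∈ chainGroup (distilledRips d ψ q L r) (q + 1) := by
    refine mem_chainGroup.2 fun τ hτ => ?_
    have hτA : τ ∈ distilledTop ψ q L := by
      by_contra h
      exact hτ (Finsupp.filter_apply_neg _ _ h)
    rw [ha_def, Finsupp.filter_apply_pos _ _ hτA] at hτ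
    obtain ⟨hτR, hcard⟩ := mem_chainGroup.1 hc τ hτ
    exact ⟨⟨hτR.1, hτR.2.1, τ, hτA, subset_rfl⟩, hcard⟩
  have haz : ∀ σ, simplexBoundary a σ ≠ 0 → σ ∈ distilledRips d ψ q L r ∧ σ.card = q + 1 := by
    intro σ hσ
    obtain ⟨τ, hτ, hστ⟩ := exists_coface_of_simplexBoundary_ne_zero hσ
    obtain ⟨hτD, hcard⟩ := mem_chainGroup.1 haD τ hτ
    obtain ⟨v, hv, rfl⟩ := covBy_iff_exists_erase.1 hστ
    have hcard' : (τ.erase v).card = q + 1 := by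
      rw [Finset.card_erase_of_mem hv]
      omega
    obtain ⟨-, hd, ν, hν, hτν⟩ := hτD
    exact ⟨⟨Finset.card_pos.1 (by omega), (simplexDiam_mono d hστ.le).trans hd, ν, hν,
      hστ.le.trans hτν⟩, hcard'⟩
  have hb0 : b = 0 := by
    refine eq_zero_of_simplexBoundary_mem (d := d) (ψ := ψ) (r := r) hL (fun τ hτ => ?_) ?_
    · have hτA : τ ∉ distilledTop ψ q L := by
        intro h
        exact hτ (Finsupp.filter_apply_neg _ _ (not_not.2 h))
      rw [hb_def, Finsupp.filter_apply_pos (· ∉ distilledTop ψ q L) _ hτA] at hτ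
      exact ⟨(mem_chainGroup_reducedRips_top hc hτ).1, hτA⟩
    -- Both ∂(a + b) and ∂a lie in D, hence so does ∂b.
    · rw [← hab, map_add] at hz
      exact (Submodule.add_mem_iff_right _ (mem_chainGroup.2 haz)).1 hz
  rw [← hab, hb0, add_zero]
  exact Submodule.mem_map.2 ⟨a, haD, rfl⟩

end Matching

theorem theorem3p6 {X : Type*} [Fintype X] [DecidableEq X]
    (d : X → X → ℝ≥0) (hd : IsSemimetric d)
    (ψ : X ≃ Fin (Fintype.card X)) (q : ℕ) (hq : 0 < q)
    (L : Finset X → Finset X) (hL : IsLuneFunction d ψ q L) :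
    (∃ Ψ : ∀ r : ℝ≥0, SimplicialHomology (reducedRips d q L r) q ≃ₗ[ZMod 2]
          SimplicialHomology (distilledRips d ψ q L r) q,
        ∀ (r₁ r₂ : ℝ≥0) (h : r₁ ≤ r₂) (c : SimplicialHomology (reducedRips d q L r₁) q),
          Ψ r₂ (homologyInclusion (reducedRips_mono d q L h) q c) =
            homologyInclusion (distilledRips_mono d ψ q L h) q (Ψ r₁ c)) ∧
    (∃ Θ : ∀ r : ℝ≥0, SimplicialHomology (vietorisRips d r) q ≃ₗ[ZMod 2]
          SimplicialHomology (distilledRips d ψ q L r) q,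
        ∀ (r₁ r₂ : ℝ≥0) (h : r₁ ≤ r₂) (c : SimplicialHomology (vietorisRips d r₁) q),
          Θ r₂ (homologyInclusion (vietorisRips_mono d h) q c) =
            homologyInclusion (distilledRips_mono d ψ q L h) q (Θ r₁ c)) := by
  refine ⟨exists_natural_equiv (distilledRips_mono d ψ q L) (reducedRips_mono d q L)
      (fun r => distilledRips_le_reducedRips hL) q fun r =>
        homologyInclusion_bijective _ q ?_ ?_,
    exists_natural_equiv (distilledRips_mono d ψ q L) (vietorisRips_mono d)
      (fun r => (distilledRips_le_reducedRips hL).trans reducedRips_le_vietorisRips) q fun r =>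
        homologyInclusion_bijective _ q ?_ ?_⟩
  · exact fun z hz hb => mem_boundaryGroup_distilledRips hL hz.1 hb
  · exact fun z hz => exists_homologous_mem_cycleGroup_distilledRips hq hL hz
  · intro z hz hb
    rw [boundaryGroup_vietorisRips hq hL] at hb
    exact mem_boundaryGroup_distilledRips hL hz.1 hb
  · intro z hz
    rw [cycleGroup_vietorisRips (L := L)] at hz
    rw [boundaryGroup_vietorisRips hq hL]
    exact exists_homologous_mem_cycleGroup_distilledRips hq hL hz
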